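/- All Banach spaces are over the same scalar field $\mathbb{K}$, where $\mathbb{K}=\mathbb{R}$ or $\mathbb{K}=\mathbb{C}$. A Banach space $Z$ is a *Grothendieck space* if every weak*-convergent sequence in its dual space $Z^*$ converges weakly. A Schauder basis $(e_n)_{n=1}^\infty$ of a Banach space $E$ is *normalized* if $\|e_n\|=1$ for each $n\in\mathbb{N}$, and *$1$-unconditional* if $$\Bigl\|\sum_{j=1}^n\alpha_j\beta_j e_j\Bigr\|\leqslant \max_{1\leqslant j\leqslant n}|\alpha_j|\cdot\Bigl\|\sum_{j=1}^n\beta_j e_j\Bigr\|$$ for each $n\in\mathbb{N}$ and all scalars $\alpha_1,\ldots,\alpha_n,\beta_1,\ldots,\beta_n$. For such a basis and a sequence $(X_n)_{n=1}^\infty$ of Banach spaces, the *$E$-direct sum* $\bigl(\bigoplus_{n\in\mathbb{N}} X_n\bigr)_E$ is the Banach space of all sequences $(x_n)$ with $x_n\in X_n$ for each $n\in\mathbb{N}$ such that the series $\sum_{n=1}^\infty\|x_n\|e_n$ converges in $E$, with coordinate-wise operations and the norm $\|(x_n)\|=\bigl\|\sum_{n=1}^\infty\|x_n\|e_n\bigr\|$.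 Write $\ell_1^m$ for $\mathbb{K}^m$ with the norm $\|(t_1,\dots,t_m)\|=\sum_{j=1}^m|t_j|$. **Corollary.** Let $X$ be a Banach space which contains a complemented subspace that is (linearly) isomorphic to $\bigl(\bigoplus_{n\in\mathbb{N}} \ell_1^{m_n}\bigr)_E$ for some unbounded sequence $(m_n)$ of natural numbers and some Banach space $E$ with a normalized, $1$-unconditional basis $(e_n)_{n=1}^\infty$. Then the Banach space $\mathscr{B}(X)$ of bounded operators on $X$, with the operator norm, is not a Grothendieck space. -/

import Mathlib

open Filter Topology

/-- A Banach space is a *Grothendieck space* if every weak*-convergent sequence in its dual space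
converges weakly, that is, with respect to the functionals in the bidual. -/
def IsGrothendieckSpace (𝕜 X : Type*) [RCLike 𝕜] [NormedAddCommGroup X] [NormedSpace 𝕜 X] : Prop :=
  ∀ (f : ℕ → StrongDual 𝕜 X) (g : StrongDual 𝕜 X),
    Tendsto (fun n => StrongDual.toWeakDual (f n)) atTop (𝓝 (StrongDual.toWeakDual g)) →
    Tendsto (fun n => toWeakSpace 𝕜 (StrongDual 𝕜 X) (f n)) atTop
      (𝓝 (toWeakSpace 𝕜 (StrongDual 𝕜 X) g))

/-- A normalized, `1`-unconditional (Schauder) basis `(eₙ)` of `E`. -/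
structure NormalizedOneUnconditionalBasis (𝕜 E : Type*) [RCLike 𝕜] [NormedAddCommGroup E]
    [NormedSpace 𝕜 E] extends GeneralSchauderBasis ℕ 𝕜 E (SummationFilter.conditional ℕ) where
  normalized : ∀ n, ‖basis n‖ = 1
  one_unconditional : ∀ (n : ℕ) (α β : ℕ → 𝕜),
    ‖∑ j ∈ Finset.range (n + 1), (α j * β j) • basis j‖ ≤
      (Finset.range (n + 1)).sup' Finset.nonempty_range_add_one (fun j => ‖α j‖) *
        ‖∑ j ∈ Finset.range (n + 1), β j • basis j‖

namespace NormalizedOneUnconditionalBasis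

variable {𝕜 E : Type*} [RCLike 𝕜] [NormedAddCommGroup E] [NormedSpace 𝕜 E]
  (b : NormalizedOneUnconditionalBasis 𝕜 E)

theorem norm_sum_le (N : ℕ) (a c : ℕ → 𝕜) (h : ∀ n, ‖a n‖ ≤ ‖c n‖) :
    ‖∑ j ∈ Finset.range N, a j • b.basis j‖ ≤ ‖∑ j ∈ Finset.range N, c j • b.basis j‖ := by
  rcases N with _ | N
  · simp
  have h1 := b.one_unconditional N (fun j => a j / c j) c
  have h2 : ∀ j, a j / c j * c j = a j := by
    intro j
    by_cases hc : c j = 0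
    · have := h j
      rw [hc, norm_zero] at this
      rw [norm_le_zero_iff.1 this]; simp
    · field_simp
  simp only [h2] at h1
  refine h1.trans (mul_le_of_le_one_left (norm_nonneg _) ?_)
  refine Finset.sup'_le _ _ fun j _ => ?_
  rw [norm_div]
  exact div_le_one_of_le₀ (h j) (norm_nonneg _)

theorem summable_iff (f : ℕ → E) : Summable f (SummationFilter.conditional ℕ) ↔
    ∃ s, Tendsto (fun N => ∑ n ∈ Finset.range N, f n) atTop (𝓝 s) := by
  simp only [Summable, HasSum, SummationFilter.conditional_filter_eq_map_range, tendsto_map'_iff]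
  rfl

theorem tendsto_tsum {f : ℕ → E} (hf : Summable f (SummationFilter.conditional ℕ)) :
    Tendsto (fun N => ∑ n ∈ Finset.range N, f n) atTop
      (𝓝 (∑'[SummationFilter.conditional ℕ] n, f n)) := by
  have := hf.hasSum
  rw [HasSum, SummationFilter.conditional_filter_eq_map_range, tendsto_map'_iff] at this
  exact this

theorem summable_of_le [CompleteSpace E] (a c : ℕ → 𝕜) (h : ∀ n, ‖a n‖ ≤ ‖c n‖)
    (hc : Summable (fun n => c n • b.basis n) (SummationFilter.conditional ℕ)) :
    Summable (fun n => a n • b.basis n) (SummationFilter.conditional ℕ) := by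
  rw [summable_iff] at hc ⊢
  obtain ⟨s, hs⟩ := hc
  apply cauchySeq_tendsto_of_complete
  have hs' := hs.cauchySeq
  rw [Metric.cauchySeq_iff'] at hs' ⊢
  intro ε hε
  obtain ⟨M, hM⟩ := hs' ε hε
  refine ⟨M, fun n hn => lt_of_le_of_lt ?_ (hM n hn)⟩
  have key : ∀ d : ℕ → 𝕜, ∑ j ∈ Finset.range n, d j • b.basis j -
      ∑ j ∈ Finset.range M, d j • b.basis j =
      ∑ j ∈ Finset.range n, (if M ≤ j then d j else 0) • b.basis j := by
    intro d
    rw [← Finset.sum_range_add_sum_Ico _ hn,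
      ← Finset.sum_range_add_sum_Ico (fun j => (if M ≤ j then d j else 0) • b.basis j) hn,
      add_sub_cancel_left, Finset.sum_eq_zero (s := Finset.range M), zero_add]
    · refine Finset.sum_congr rfl fun j hj => ?_
      rw [if_pos (Finset.mem_Ico.1 hj).1]
    · intro j hj
      rw [if_neg (not_le.2 (Finset.mem_range.1 hj)), zero_smul]
  rw [dist_eq_norm, dist_eq_norm, key, key]
  refine b.norm_sum_le n _ _ fun j => ?_
  split_ifs
  · exact h j
  · simp

theorem norm_tsum_le {a c : ℕ → 𝕜} (h : ∀ n, ‖a n‖ ≤ ‖c n‖)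
    (ha : Summable (fun n => a n • b.basis n) (SummationFilter.conditional ℕ))
    (hc : Summable (fun n => c n • b.basis n) (SummationFilter.conditional ℕ)) :
    ‖∑'[SummationFilter.conditional ℕ] n, a n • b.basis n‖ ≤
      ‖∑'[SummationFilter.conditional ℕ] n, c n • b.basis n‖ :=
  le_of_tendsto_of_tendsto' (tendsto_tsum ha).norm (tendsto_tsum hc).norm
    fun N => b.norm_sum_le N a c h

theorem norm_coeff_le {c : ℕ → 𝕜}
    (hc : Summable (fun n => c n • b.basis n) (SummationFilter.conditional ℕ)) (n : ℕ) :
    ‖c n‖ ≤ ‖∑'[SummationFilter.conditional ℕ] n, c n • b.basis n‖ := by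
  refine ge_of_tendsto (tendsto_tsum hc).norm ?_
  filter_upwards [eventually_gt_atTop n] with N hN
  have := b.norm_sum_le N (Pi.single n (c n)) c (fun j => by
    by_cases hj : j = n
    · subst hj; simp
    · simp [hj])
  refine le_trans (le_of_eq ?_) this
  rw [Finset.sum_eq_single n]
  · simp [norm_smul, b.normalized]
  · intro j _ hj; simp [hj]
  · intro hn; exact absurd (Finset.mem_range.2 hN) hn

variable [CompleteSpace E] (X : ℕ → Type*) [∀ n, NormedAddCommGroup (X n)]
  [∀ n, NormedSpace 𝕜 (X n)]

/-- The sequences `(xₙ)` with `xₙ ∈ Xₙ` for which the series `∑ ‖xₙ‖ eₙ` converges in `E`. -/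
def directSumSubmodule : Submodule 𝕜 (∀ n, X n) where
  carrier := {x | Summable (fun n => ((‖x n‖ : ℝ) : 𝕜) • b.basis n) (SummationFilter.conditional ℕ)}
  zero_mem' := by
    rw [Set.mem_ofPred_eq, summable_iff]
    exact ⟨0, by simp⟩
  add_mem' := by
    intro x y hx hy
    rw [Set.mem_ofPred_eq] at hx hy ⊢
    refine b.summable_of_le _ (fun n => ((‖x n‖ + ‖y n‖ : ℝ) : 𝕜)) (fun n => ?_) ?_
    · rw [RCLike.norm_ofReal, RCLike.norm_ofReal, abs_norm, abs_of_nonneg (by positivity)]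
      exact norm_add_le _ _
    · have := hx.add hy
      simpa only [RCLike.ofReal_add, add_smul] using this
  smul_mem' := by
    intro r x hx
    rw [Set.mem_ofPred_eq] at hx ⊢
    have := hx.const_smul ((‖r‖ : ℝ) : 𝕜)
    simpa only [Pi.smul_apply, norm_smul, RCLike.ofReal_mul, mul_smul] using this

/-- The `E`-direct sum of the sequence `(Xₙ)` with respect to the given basis of `E`, with the
coordinate-wise operations. It is a type of its own, so that it carries the norm defined below and
not the topology of the product. -/
def DirectSum : Type _ := ↥(b.directSumSubmodule X)

noncomputable instance : AddCommGroup (b.DirectSum X) :=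
  inferInstanceAs (AddCommGroup ↥(b.directSumSubmodule X))

noncomputable instance : Module 𝕜 (b.DirectSum X) :=
  inferInstanceAs (Module 𝕜 ↥(b.directSumSubmodule X))

/-- The norm `‖(xₙ)‖ = ‖∑ ‖xₙ‖ eₙ‖`. -/
noncomputable instance : Norm (b.DirectSum X) where
  norm x := ‖∑'[SummationFilter.conditional ℕ] n, ((‖x.1 n‖ : ℝ) : 𝕜) • b.basis n‖

theorem directSum_norm_def (x : b.DirectSum X) :
    ‖x‖ = ‖∑'[SummationFilter.conditional ℕ] n, ((‖x.1 n‖ : ℝ) : 𝕜) • b.basis n‖ := rfl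

theorem directSum_core : NormedSpace.Core 𝕜 (b.DirectSum X) where
  norm_nonneg x := norm_nonneg (_ : E)
  norm_smul r x := by
    have hx : Summable _ (SummationFilter.conditional ℕ) := x.2
    have h : ∀ n, ((‖(r • x).1 n‖ : ℝ) : 𝕜) • b.basis n =
        ((‖r‖ : ℝ) : 𝕜) • (((‖x.1 n‖ : ℝ) : 𝕜) • b.basis n) := by
      intro n
      change ((‖r • x.1 n‖ : ℝ) : 𝕜) • b.basis n = _
      rw [norm_smul, RCLike.ofReal_mul, mul_smul]
    rw [directSum_norm_def, directSum_norm_def]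
    simp only [h]
    rw [hx.tsum_const_smul, _root_.norm_smul, RCLike.norm_ofReal, abs_norm]
  norm_triangle x y := by
    have hx : Summable _ (SummationFilter.conditional ℕ) := x.2
    have hy : Summable _ (SummationFilter.conditional ℕ) := y.2
    have hxy : Summable _ (SummationFilter.conditional ℕ) := (x + y).2
    have hs : Summable (fun n => ((‖x.1 n‖ + ‖y.1 n‖ : ℝ) : 𝕜) • b.basis n)
        (SummationFilter.conditional ℕ) := by
      simpa only [RCLike.ofReal_add, add_smul] using hx.add hy
    refine (b.norm_tsum_le (fun n => ?_) hxy hs).trans ?_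
    · rw [RCLike.norm_ofReal, RCLike.norm_ofReal, abs_norm, abs_of_nonneg (by positivity)]
      exact norm_add_le _ _
    · simp only [RCLike.ofReal_add, add_smul]
      rw [hx.tsum_add hy]
      exact norm_add_le _ _
  norm_eq_zero_iff x := by
    have hx : Summable _ (SummationFilter.conditional ℕ) := x.2
    constructor
    · intro h
      refine Subtype.ext (funext fun n => ?_)
      have := b.norm_coeff_le hx n
      rw [directSum_norm_def] at h
      rw [h, RCLike.norm_ofReal, abs_norm] at this
      exact norm_le_zero_iff.1 this
    · rintro rfl
      rw [directSum_norm_def]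
      have h : ∀ n, ((‖(0 : b.DirectSum X).1 n‖ : ℝ) : 𝕜) • b.basis n = 0 := by
        intro n
        change ((‖(0 : X n)‖ : ℝ) : 𝕜) • b.basis n = 0
        simp
      simp only [h, tsum_zero, norm_zero]

noncomputable instance : NormedAddCommGroup (b.DirectSum X) :=
  NormedAddCommGroup.ofCore (b.directSum_core X)

noncomputable instance : NormedSpace 𝕜 (b.DirectSum X) :=
  NormedSpace.ofCore (b.directSum_core X)

end NormalizedOneUnconditionalBasis

/-! The space of operators maps onto `ℓ₁`, which is incompatible with the Grothendieck property.
Compress an operator `T` to the complemented direct sum and apply it to the first unit vector of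
block `n`. The block `n` part of the result is a vector of `ℓ₁^{m n}` of norm at most a constant
times `‖T‖`. Its `j`-th coordinates, taken to the limit along an ultrafilter on which `m n → ∞`,
give functionals `φ j` with `∑ |φ j T| ≤ C ‖T‖`. Conversely, the operators sending the first unit
vector to the `i`-th one in every block at once are uniformly bounded, because unconditionality
controls block-diagonal operators, and they are biorthogonal to the `φ j`. Such a system is excluded
by `not_isGrothendieckSpace_of_biorthogonal`: the partial sums of the `φ j` converge weakly*, but a
functional in the bidual detects the escaping tail. -/

/-! ### Ultrafilter limits of functionals and a criterion for failing the Grothendieck property. -/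

/-- **Banach–Alaoglu along an ultrafilter**: a bounded family of functionals converges pointwise
along every ultrafilter. -/
theorem exists_strongDual_tendsto_ultrafilter {𝕜 Z ι : Type*} [RCLike 𝕜] [NormedAddCommGroup Z]
    [NormedSpace 𝕜 Z] (U : Ultrafilter ι) (f : ι → StrongDual 𝕜 Z) (C : ℝ)
    (hf : ∀ i, ‖f i‖ ≤ C) :
    ∃ g : StrongDual 𝕜 Z, ∀ z, Tendsto (fun i => f i z) U (𝓝 (g z)) := by
  have hK := WeakDual.isCompact_closedBall (𝕜 := 𝕜) (0 : StrongDual 𝕜 Z) C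
  obtain ⟨g, -, hg⟩ := hK.ultrafilter_le_nhds
    (U.map fun i => StrongDual.toWeakDual (f i)) (by
      rw [le_principal_iff]
      refine mem_map.2 (Eventually.of_forall fun i => ?_)
      exact mem_closedBall_zero_iff.2 (hf i))
  refine ⟨WeakDual.toStrongDual g, fun z => ?_⟩
  exact ((WeakDual.eval_continuous z).tendsto g).comp hg

/-- A normed space with a bounded sequence that is biorthogonal to a weakly* unconditionally
summable sequence of functionals (so that it maps onto `ℓ₁`) is not a Grothendieck space. -/
theorem not_isGrothendieckSpace_of_biorthogonal {𝕜 Z : Type*} [RCLike 𝕜] [NormedAddCommGroup Z]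
    [NormedSpace 𝕜 Z] (φ : ℕ → StrongDual 𝕜 Z) (z : ℕ → Z) (C c : ℝ)
    (hφ : ∀ (k : ℕ) (x : Z), ∑ j ∈ Finset.range k, ‖φ j x‖ ≤ C * ‖x‖)
    (hz : ∀ i, ‖z i‖ ≤ c) (h : ∀ i j, φ j (z i) = if j = i then 1 else 0) :
    ¬ IsGrothendieckSpace 𝕜 Z := by
  intro hG
  let U : Ultrafilter ℕ := hyperfilter ℕ
  have hU : (U : Filter ℕ) ≤ atTop := by
    simpa only [Nat.cofinite_eq_atTop] using hyperfilter_le_cofinite (α := ℕ)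
  let f : ℕ → StrongDual 𝕜 Z := fun k => ∑ j ∈ Finset.range k, φ j
  have hf : ∀ k x, f k x = ∑ j ∈ Finset.range k, φ j x := fun k x => by simp [f]
  have hfC : ∀ k, ‖f k‖ ≤ |C| := fun k =>
    (f k).opNorm_le_bound (abs_nonneg C) fun x => by
      rw [hf]
      exact (norm_sum_le _ _).trans ((hφ k x).trans
        (mul_le_mul_of_nonneg_right (le_abs_self C) (norm_nonneg x)))
  obtain ⟨F, hF⟩ := exists_strongDual_tendsto_ultrafilter U f _ hfC
  -- The ultrafilter limit only supplies a continuous `F`; absolute convergence of the series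
  -- upgrades this to convergence of the whole sequence.
  have hlim : ∀ x, Tendsto (fun k => f k x) atTop (𝓝 (F x)) := by
    intro x
    have hs : Summable fun j => φ j x :=
      (summable_of_sum_range_le (fun _ => norm_nonneg _) fun k => hφ k x).of_norm
    have ht := hs.hasSum.tendsto_sum_nat
    simp only [← hf] at ht
    rwa [tendsto_nhds_unique (hF x) (ht.mono_left hU)]
  have hweak := hG f F (tendsto_iff_forall_eval_tendsto_topDualPairing.2 hlim)
  -- `Φ` is a weak* limit of the `z i` in the bidual. It takes the limit in `i` before the limit in
  -- `k`, and the two iterated limits of `f k (z i)` are 0 and 1.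
  obtain ⟨Φ, hΦ⟩ := exists_strongDual_tendsto_ultrafilter U
    (fun i => NormedSpace.inclusionInDoubleDual 𝕜 Z (z i)) c fun i =>
      (NormedSpace.double_dual_bound 𝕜 Z (z i)).trans (hz i)
  have hfz : ∀ k i, f k (z i) = if i < k then 1 else 0 := fun k i => by
    simp [hf, h]
  have hΦf : ∀ k, Φ (f k) = 0 := by
    intro k
    refine tendsto_nhds_unique (hΦ (f k)) (tendsto_const_nhds.congr' ?_)
    filter_upwards [hU (eventually_ge_atTop k)] with i hi
    change 0 = f k (z i)
    rw [hfz, if_neg hi.not_gt]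
  have hΦF : Φ F = 1 := by
    refine tendsto_nhds_unique (hΦ F) (tendsto_const_nhds.congr fun i => ?_)
    change 1 = F (z i)
    refine tendsto_nhds_unique (tendsto_const_nhds.congr' ?_) (hlim (z i))
    filter_upwards [eventually_gt_atTop i] with k hk
    rw [hfz, if_pos hk]
  have hconv : Tendsto (fun k => Φ (f k)) atTop (𝓝 (Φ F)) :=
    ((WeakBilin.eval_continuous (topDualPairing 𝕜 (StrongDual 𝕜 Z)).flip Φ).tendsto _).comp hweak
  simp only [hΦf, hΦF] at hconv
  exact zero_ne_one (tendsto_nhds_unique tendsto_const_nhds hconv)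

/-! ### Block projections, embeddings and diagonal operators on `E`-direct sums. -/

namespace NormalizedOneUnconditionalBasis

variable {𝕜 E : Type*} [RCLike 𝕜] [NormedAddCommGroup E] [NormedSpace 𝕜 E]
  (b : NormalizedOneUnconditionalBasis 𝕜 E) [CompleteSpace E] (X : ℕ → Type*)
  [∀ n, NormedAddCommGroup (X n)] [∀ n, NormedSpace 𝕜 (X n)]

/-- The coordinate projections of an `E`-direct sum. -/
noncomputable def blockProj (n : ℕ) : b.DirectSum X →L[𝕜] X n :=
  LinearMap.mkContinuous
    { toFun := fun x => x.1 n
      map_add' := fun _ _ => rfl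
      map_smul' := fun _ _ => rfl } 1 fun x => by
    have hx : Summable _ (SummationFilter.conditional ℕ) := x.2
    have := b.norm_coeff_le hx n
    rw [RCLike.norm_ofReal, abs_norm] at this
    rw [one_mul]
    exact this

theorem norm_blockProj_apply_le (n : ℕ) (x : b.DirectSum X) : ‖b.blockProj X n x‖ ≤ ‖x‖ := by
  simpa using (b.blockProj X n).le_of_opNorm_le (LinearMap.mkContinuous_norm_le _ zero_le_one _) x

variable {X}

theorem exists_directSum_single (n : ℕ) (v : X n) :
    ∃ u : b.DirectSum X, b.blockProj X n u = v ∧ ‖u‖ ≤ ‖v‖ := by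
  have hs : HasSum (fun k => ((‖(Pi.single n v : ∀ k, X k) k‖ : ℝ) : 𝕜) • b.basis k)
      (((‖v‖ : ℝ) : 𝕜) • b.basis n) (SummationFilter.conditional ℕ) := by
    rw [HasSum, SummationFilter.conditional_filter_eq_map_range, tendsto_map'_iff]
    refine tendsto_const_nhds.congr' ?_
    filter_upwards [eventually_gt_atTop n] with N hN
    rw [Function.comp_apply, Finset.sum_eq_single_of_mem n (Finset.mem_range.2 hN)]
    · simp
    · intro k _ hk
      simp [Pi.single_eq_of_ne hk]
  refine ⟨⟨Pi.single n v, hs.summable⟩, Pi.single_eq_same n v, ?_⟩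
  refine (congrArg norm hs.tsum_eq).trans_le ?_
  rw [norm_smul, b.normalized, mul_one, RCLike.norm_ofReal, abs_norm]

theorem summable_diagonal (A : ∀ n, X n →ₗ[𝕜] X n) (hA : ∀ n x, ‖A n x‖ ≤ ‖x‖)
    (x : b.DirectSum X) : Summable (fun n => ((‖A n (x.1 n)‖ : ℝ) : 𝕜) • b.basis n)
      (SummationFilter.conditional ℕ) :=
  b.summable_of_le _ (fun n => ((‖x.1 n‖ : ℝ) : 𝕜)) (fun n => by
    simpa only [RCLike.norm_ofReal, abs_norm] using hA n (x.1 n)) x.2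

/-- This is where 1-unconditionality enters the bound on diagonal operators. -/
theorem directSum_norm_mono {x y : b.DirectSum X} (h : ∀ n, ‖x.1 n‖ ≤ ‖y.1 n‖) : ‖x‖ ≤ ‖y‖ :=
  b.norm_tsum_le (fun n => by simpa only [RCLike.norm_ofReal, abs_norm] using h n) x.2 y.2

/-- The diagonal operator on an `E`-direct sum given by contractions of the summands. -/
noncomputable def diagonal (A : ∀ n, X n →ₗ[𝕜] X n) (hA : ∀ n x, ‖A n x‖ ≤ ‖x‖) :
    b.DirectSum X →L[𝕜] b.DirectSum X :=
  LinearMap.mkContinuous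
    { toFun := fun x => ⟨fun n => A n (x.1 n), b.summable_diagonal A hA x⟩
      map_add' := fun x y => Subtype.ext (funext fun n => (A n).map_add (x.1 n) (y.1 n))
      map_smul' := fun r x => Subtype.ext (funext fun n => (A n).map_smul r (x.1 n)) } 1
    fun x => (b.directSum_norm_mono fun n => hA n (x.1 n)).trans_eq (one_mul _).symm

theorem norm_diagonal_le (A : ∀ n, X n →ₗ[𝕜] X n) (hA : ∀ n x, ‖A n x‖ ≤ ‖x‖) :
    ‖b.diagonal A hA‖ ≤ 1 :=
  LinearMap.mkContinuous_norm_le _ zero_le_one fun x =>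
    (b.directSum_norm_mono fun n => hA n (x.1 n)).trans_eq (one_mul _).symm

theorem blockProj_diagonal (A : ∀ n, X n →ₗ[𝕜] X n) (hA : ∀ n x, ‖A n x‖ ≤ ‖x‖) (n : ℕ)
    (x : b.DirectSum X) : b.blockProj X n (b.diagonal A hA x) = A n (b.blockProj X n x) := rfl

end NormalizedOneUnconditionalBasis

/-! ### Coordinates in `ℓ₁ᵐ`, indexed by all naturals so that `m` can vary. -/

/-- The `j`-th coordinate functional on `ℓ₁ᵐ`, which is zero if `m ≤ j`. -/
noncomputable def ellOneCoord (𝕜 : Type*) [RCLike 𝕜] (m j : ℕ) :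
    StrongDual 𝕜 (PiLp 1 (fun _ : Fin m => 𝕜)) :=
  if h : j < m then PiLp.proj 1 (fun _ : Fin m => 𝕜) ⟨j, h⟩ else 0

/-- The `j`-th unit vector of `ℓ₁ᵐ`, which is zero if `m ≤ j`. -/
noncomputable def ellOneSingle (𝕜 : Type*) [RCLike 𝕜] (m j : ℕ) : PiLp 1 (fun _ : Fin m => 𝕜) :=
  if h : j < m then PiLp.single 1 ⟨j, h⟩ 1 else 0

theorem ellOneCoord_ellOneSingle {𝕜 : Type*} [RCLike 𝕜] {m i : ℕ} (hi : i < m) (j : ℕ) :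
    ellOneCoord 𝕜 m j (ellOneSingle 𝕜 m i) = if j = i then 1 else 0 := by
  rw [ellOneSingle, dif_pos hi, ellOneCoord]
  by_cases hj : j < m
  · simp [hj]
  · simp [hj, show j ≠ i by omega]

theorem norm_ellOneSingle_le (𝕜 : Type*) [RCLike 𝕜] (m j : ℕ) : ‖ellOneSingle 𝕜 m j‖ ≤ 1 := by
  rw [ellOneSingle]
  split_ifs
  · simp
  · simp

/-- Coordinates beyond `m` vanish, so `k` may exceed `m`. The constant 1, independent of `m`, is
what makes the limit functionals summable. -/
theorem sum_norm_ellOneCoord_le {𝕜 : Type*} [RCLike 𝕜] (m k : ℕ)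
    (v : PiLp 1 (fun _ : Fin m => 𝕜)) :
    ∑ j ∈ Finset.range k, ‖ellOneCoord 𝕜 m j v‖ ≤ ‖v‖ := by
  have hv : ‖v‖ = ∑ j ∈ Finset.range m, ‖ellOneCoord 𝕜 m j v‖ := by
    rw [PiLp.norm_eq_of_L1, Finset.sum_range]
    exact Finset.sum_congr rfl fun j _ => by simp [ellOneCoord]
  rw [hv, ← Finset.sum_filter_add_sum_filter_not (Finset.range k) (· < m),
    Finset.sum_eq_zero (s := (Finset.range k).filter fun j => ¬ j < m), add_zero]
  · refine Finset.sum_le_sum_of_subset_of_nonneg (fun j hj => ?_) fun _ _ _ => norm_nonneg _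
    exact Finset.mem_range.2 (Finset.mem_filter.1 hj).2
  · intro j hj
    rw [ellOneCoord, dif_neg (Finset.mem_filter.1 hj).2]
    simp

theorem norm_ellOneCoord_apply_le {𝕜 : Type*} [RCLike 𝕜] (m j : ℕ)
    (v : PiLp 1 (fun _ : Fin m => 𝕜)) : ‖ellOneCoord 𝕜 m j v‖ ≤ ‖v‖ :=
  (Finset.single_le_sum (f := fun j => ‖ellOneCoord 𝕜 m j v‖) (fun _ _ => norm_nonneg _)
    (Finset.self_mem_range_succ j)).trans (sum_norm_ellOneCoord_le m (j + 1) v)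

/-! ### The biorthogonal system in the space of operators. -/

theorem corollary2p3 {𝕜 X E : Type*} [RCLike 𝕜]
    [NormedAddCommGroup X] [NormedSpace 𝕜 X] [CompleteSpace X]
    [NormedAddCommGroup E] [NormedSpace 𝕜 E] [CompleteSpace E]
    (b : NormalizedOneUnconditionalBasis 𝕜 E)
    (m : ℕ → ℕ) (hm : ¬ BddAbove (Set.range m))
    (h : ∃ Y : Submodule 𝕜 X, Y.ClosedComplemented ∧
      Nonempty (Y ≃L[𝕜] b.DirectSum (fun n => PiLp 1 (fun _ : Fin (m n) => 𝕜)))) :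
    ¬ IsGrothendieckSpace 𝕜 (X →L[𝕜] X) := by
  obtain ⟨Y, ⟨p, hp⟩, ⟨e⟩⟩ := h
  let W : ℕ → Type _ := fun n => PiLp 1 (fun _ : Fin (m n) => 𝕜)
  let P : X →L[𝕜] b.DirectSum W := (e : Y →L[𝕜] b.DirectSum W) ∘L p
  let J : b.DirectSum W →L[𝕜] X := Y.subtypeL ∘L (e.symm : b.DirectSum W →L[𝕜] Y)
  have hPJ : ∀ x, P (J x) = x := fun x => by
    change e (p (e.symm x : X)) = x
    rw [hp, e.apply_symm_apply]
  -- Unboundedness of `m` yields an ultrafilter along which `m n → ∞`, replacing the passage to a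
  -- subsequence.
  have hne : (comap m atTop).NeBot := by
    refine comap_neBot fun t ht => ?_
    obtain ⟨N, hN⟩ := mem_atTop_sets.1 ht
    obtain ⟨_, ⟨n, rfl⟩, hn⟩ := not_bddAbove_iff.1 hm N
    exact ⟨n, hN _ hn.le⟩
  let U : Ultrafilter ℕ := Ultrafilter.of (comap m atTop)
  have hmU : Tendsto m U atTop := tendsto_comap.mono_left (Ultrafilter.of_le _)
  choose u hu hu1 using fun n => b.exists_directSum_single (X := W) n (ellOneSingle 𝕜 (m n) 0)
  let a : ℕ → ℕ → StrongDual 𝕜 (X →L[𝕜] X) := fun j n =>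
    ellOneCoord 𝕜 (m n) j ∘L b.blockProj W n ∘L P ∘L ContinuousLinearMap.apply 𝕜 X (J (u n))
  have ha : ∀ j n T, a j n T = ellOneCoord 𝕜 (m n) j (b.blockProj W n (P (T (J (u n))))) :=
    fun _ _ _ => rfl
  have hbound : ∀ n (T : X →L[𝕜] X),
      ‖b.blockProj W n (P (T (J (u n))))‖ ≤ ‖P‖ * ‖J‖ * ‖T‖ := by
    intro n T
    have hJ : ‖J (u n)‖ ≤ ‖J‖ :=
      J.unit_le_opNorm _ ((hu1 n).trans (norm_ellOneSingle_le 𝕜 (m n) 0))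
    calc ‖b.blockProj W n (P (T (J (u n))))‖ ≤ ‖P (T (J (u n)))‖ := b.norm_blockProj_apply_le W n _
      _ ≤ ‖P‖ * (‖T‖ * ‖J‖) := P.le_opNorm_of_le (T.le_opNorm_of_le hJ)
      _ = ‖P‖ * ‖J‖ * ‖T‖ := by ring
  have hanorm : ∀ j n, ‖a j n‖ ≤ ‖P‖ * ‖J‖ := fun j n =>
    (a j n).opNorm_le_bound (by positivity) fun T =>
      (norm_ellOneCoord_apply_le (m n) j _).trans (hbound n T)
  choose φ hφ using fun j => exists_strongDual_tendsto_ultrafilter U (a j) _ (hanorm j)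
  -- On each block, the rank-one contraction `x ↦ x₀ eᵢ`, which is zero when `m n ≤ i`.
  let A : ℕ → ∀ n, W n →ₗ[𝕜] W n := fun i n =>
    (ellOneCoord 𝕜 (m n) 0).toLinearMap.smulRight (ellOneSingle 𝕜 (m n) i)
  have hA : ∀ i n x, ‖A i n x‖ ≤ ‖x‖ := by
    intro i n x
    change ‖ellOneCoord 𝕜 (m n) 0 x • ellOneSingle 𝕜 (m n) i‖ ≤ ‖x‖
    rw [norm_smul]
    exact (mul_le_of_le_one_right (norm_nonneg _) (norm_ellOneSingle_le 𝕜 _ _)).trans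
      (norm_ellOneCoord_apply_le (m n) 0 x)
  refine not_isGrothendieckSpace_of_biorthogonal φ
    (fun i => J ∘L b.diagonal (A i) (hA i) ∘L P) (‖P‖ * ‖J‖) (‖J‖ * (1 * ‖P‖)) ?_ ?_ ?_
  · intro k T
    -- The `ℓ₁` bound holds for each `n` and passes to the limit since the sum is finite.
    refine le_of_tendsto (tendsto_finsetSum _ fun j _ => (hφ j T).norm)
      (Eventually.of_forall fun n => ?_)
    exact (sum_norm_ellOneCoord_le (m n) k _).trans (hbound n T)
  · intro i
    refine (J.opNorm_comp_le _).trans (mul_le_mul_of_nonneg_left ?_ (norm_nonneg _))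
    exact (ContinuousLinearMap.opNorm_comp_le _ _).trans
      (mul_le_mul_of_nonneg_right (b.norm_diagonal_le _ _) (norm_nonneg _))
  · intro i j
    refine tendsto_nhds_unique (hφ j _) (tendsto_const_nhds.congr' ?_)
    -- Once block `n` has an `i`-th coordinate, the value is exactly the Kronecker delta, so the
    -- limit is of an eventually constant family.
    filter_upwards [hmU (eventually_gt_atTop i)] with n hn
    have hn : i < m n := hn
    change _ = ellOneCoord 𝕜 (m n) j
      (b.blockProj W n (P (J (b.diagonal (A i) (hA i) (P (J (u n)))))))
    rw [hPJ, hPJ, b.blockProj_diagonal, hu]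
    change _ = ellOneCoord 𝕜 (m n) j
      (ellOneCoord 𝕜 (m n) 0 (ellOneSingle 𝕜 (m n) 0) • ellOneSingle 𝕜 (m n) i)
    rw [ellOneCoord_ellOneSingle (by omega), if_pos rfl, one_smul, ellOneCoord_ellOneSingle hn]
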